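/- Let $M=M_2(\mathbb{C})$ with $*$ the conjugate transpose. Let $\mathfrak{g}=\mathfrak{sl}(2,\mathbb{C})$ carry the bracket $i[\cdot,\cdot]$ and the involution $*$, with basis $S_j=\frac12\sigma_j$ ($\sigma_j$ the Pauli matrices) and dual basis $h^j$, acting on $M$ by the derivations $\rho(B)=i[B,\cdot]$. Let $(\Omega^\bullet(M),d,*)$ be the Chevalley–Eilenberg complex of $M$-valued alternating multilinear maps on $\mathfrak{g}$, with $\mu^*(X_1,\dots,X_k)=\mu(X_1^*,\dots,X_k^*)^*$. Put $$\Big\langle \sum_{j_1<\dots<j_k} h^{j_1}\wedge\dots\wedge h^{j_k}\,\hat p_{j_1\dots j_k},\ \sum_{j_1<\dots<j_k} h^{j_1}\wedge\dots\wedge h^{j_k}\,p_{j_1\dots j_k}\Big\rangle_L=\sum_{j_1<\dots<j_k}\hat p_{j_1\dots j_k}\,p_{j_1\dots j_k}^*,\qquad \langle\hat\mu,\mu\rangle_R=\langle\hat\mu^*,\mu^*\rangle_L,$$ $\mathrm{dvol}=h^1\wedge h^2\wedge h^3\,\mathrm{Id}$ and $\int_M p\,\mathrm{dvol}=\frac12\mathrm{tr}(p)$.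 Let $G=\mathbb{C}[z,z^{-1}]$ be the $*$-Hopf algebra of $U(1)$ (comultiplication $\phi$, counit $\epsilon$, antipode $\kappa$) with its classical differential calculus $\Gamma^\wedge=G\oplus\Gamma$, $\Gamma=G\otimes{}_{\mathrm{inv}}\Gamma$. Here ${}_{\mathrm{inv}}\Gamma=\mathrm{Ker}(\epsilon)/\mathrm{Ker}(\epsilon)^2$ is spanned by $\varsigma=\pi(z)$, where $\pi(g)=[g-\epsilon(g)]$, and $\pi(g)^*=-\pi(\kappa(g)^*)$, $dg=g^{(1)}\pi(g^{(2)})$, $\mathrm{ad}(\theta)=\theta\otimes 1$, and the embedded differential is $\delta=0$. Consider the trivial quantum principal $U(1)$-bundle $GM=M\otimes G$ with calculus $\Omega^\bullet(GM)=\Omega^\bullet(M)\otimes\Gamma^\wedge$ (graded tensor product) and coaction $\Psi=\mathrm{id}\otimes\phi:\Omega^\bullet(GM)\to\Omega^\bullet(GM)\otimes\Gamma^\wedge$, where $\phi$ is extended to $\Gamma^\wedge$. A quantum principal connection (qpc) is a linear map $\omega:{}_{\mathrm{inv}}\Gamma\to\Omega^1(GM)$ with $\Psi(\omega(\theta))=(\omega\otimes\mathrm{id})\mathrm{ad}(\theta)+1\otimes\theta$.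 A displacement is a linear map $\lambda:{}_{\mathrm{inv}}\Gamma\to\Omega^1(GM)$ with $\Psi(\lambda(\theta))=(\lambda\otimes\mathrm{id})\mathrm{ad}(\theta)$. The curvature is $R^\omega=d\circ\omega-\langle\omega,\omega\rangle$, where $\langle\omega,\omega\rangle=m\circ(\omega\otimes\omega)\circ\delta$ and $m$ is the product of $\Omega^\bullet(GM)$; $\omega$ is flat if $R^\omega=0$. Put $\widehat R^\omega=*\circ R^\omega\circ *$. The values $R^\omega(\varsigma)$ and $\widehat R^\omega(\varsigma)$ lie in $\Omega^2(M)\otimes 1\cong\Omega^2(M)$, and the Yang–Mills action is $$\mathscr S_{YM}(\omega)=-\tfrac14\int_M\big(\langle R^\omega(\varsigma),R^\omega(\varsigma)\rangle_L+\langle\widehat R^\omega(\varsigma),\widehat R^\omega(\varsigma)\rangle_R\big)\mathrm{dvol}.$$ A qpc $\omega$ is a Yang–Mills qpc if $\frac{\partial}{\partial z}\big|_{z=0}\mathscr S_{YM}(\omega+z\lambda)=0$ (Wirtinger derivative in $z\in\mathbb{C}$) for every displacement $\lambda$. Claim. The first cohomology of the Chevalley–Eilenberg complex vanishes: $\mathrm{Ker}(d|_{\Omega^1(M)})=d(M)$.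 Every Yang–Mills qpc $\omega$ is flat, $R^\omega=0$. There is a unique linear map $A^\omega:{}_{\mathrm{inv}}\Gamma\to\Omega^1(M)$ (the gauge potential) with $\omega=\omega^{\mathrm{triv}}+(A^\omega\otimes\mathrm{id})\circ\mathrm{ad}$, where $\omega^{\mathrm{triv}}(\theta)=1\otimes\theta$. Its field strength $F^\omega=d\circ A^\omega-\langle A^\omega,A^\omega\rangle$, with $\langle A^\omega,A^\omega\rangle$ formed by $\delta$ and the product of $\Omega^\bullet(M)$, satisfies $R^\omega=(F^\omega\otimes\mathrm{id})\circ\mathrm{ad}$ and $F^\omega(\varsigma)=dA^\omega(\varsigma)=0$, and $A^\omega(\varsigma)=dp$ for some $p\in M$. -/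

import Mathlib

open scoped TensorProduct

set_option maxSynthPendingDepth 3

noncomputable section

namespace NCYM

/-! ### The algebra `M₂(ℂ)`, the `*`-Lie algebra `(sl(2,ℂ), i[·,·])` and its action on `M₂(ℂ)` -/

/-- The quantum base space: the `*`-algebra of complex `2 × 2` matrices. -/
abbrev M2 : Type := Matrix (Fin 2) (Fin 2) ℂ

/-- The vector space `sl(2,ℂ)` of traceless matrices. Its Lie bracket in this construction is
`i[X, Y]`, see `adI`; the instance bracket of Mathlib is the commutator. -/
abbrev SL2 : Type := LieAlgebra.SpecialLinear.sl (Fin 2) ℂ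

/-- The bracket `(X, Y) ↦ i[X, Y]` of the `*`-Lie algebra `sl(2,ℂ)`. -/
def adI : SL2 →ₗ[ℂ] SL2 →ₗ[ℂ] SL2 :=
  LinearMap.mk₂ ℂ (fun X Y => Complex.I • ⁅X, Y⁆)
    (by intros; simp) (by intros; simp [smul_comm Complex.I])
    (by intros; simp) (by intros; simp [smul_comm Complex.I])

/-- The representation `ρ(B) = i[B, ·]` of `sl(2,ℂ)` by derivations of `M₂(ℂ)`. -/
def rho : SL2 →ₗ[ℂ] M2 →ₗ[ℂ] M2 :=
  LinearMap.mk₂ ℂ (fun B p => Complex.I • ((B : M2) * p - p * (B : M2)))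
    (by intros; simp [add_mul, mul_add]; module)
    (by intros; simp [smul_comm Complex.I, smul_sub])
    (by intros; simp [add_mul, mul_add]; module)
    (by intros; simp [smul_comm Complex.I, smul_sub])

/-- The involution of `sl(2,ℂ)`: conjugate transpose. -/
def starSL2 (B : SL2) : SL2 :=
  ⟨star (B : M2), by
    have h : Matrix.trace (B : M2) = 0 := B.2
    change Matrix.trace (star (B : M2)) = 0
    rw [Matrix.star_eq_conjTranspose, Matrix.trace_conjTranspose, h, star_zero]⟩

/-- The Pauli matrices. -/
def pauli : Fin 3 → M2 :=
  ![!![0, 1; 1, 0], !![0, -Complex.I; Complex.I, 0], !![1, 0; 0, -1]]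

/-- The basis `S_j = σ_j / 2` of `sl(2,ℂ)` (indices `0, 1, 2` instead of `1, 2, 3`). -/
def S (j : Fin 3) : SL2 :=
  ⟨(1 / 2 : ℂ) • pauli j, by
    change Matrix.trace ((1 / 2 : ℂ) • pauli j) = 0
    fin_cases j <;> simp [pauli, Matrix.trace_fin_two]⟩

/-- The coordinates `h^j(B) = 2 tr(S_j B)`; `h^0, h^1, h^2` is the basis dual to `S`. -/
def coord : SL2 →ₗ[ℂ] (Fin 3 → ℂ) where
  toFun B j := 2 * Matrix.trace ((S j : M2) * (B : M2))
  map_add' := by intros; ext; simp [mul_add]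
  map_smul' := by intros; ext; simp; ring

lemma coord_S (i : Fin 3) : coord (S i) = Pi.single i 1 := by
  ext j
  fin_cases i <;> fin_cases j <;>
    simp [coord, S, pauli, Matrix.trace_fin_two, Matrix.mul_apply, Fin.sum_univ_two] <;>
    ring_nf <;> simp

/-! ### The Chevalley–Eilenberg complex `Ω^•(M)` -/

/-- `Ω^k(M)`: alternating `k`-linear maps on `sl(2,ℂ)` with values in `M = M₂(ℂ)`. -/
abbrev Form (k : ℕ) : Type := SL2 [⋀^Fin k]→ₗ[ℂ] M2

/-- The identification `M = Ω^0(M)`. -/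
def ofM : M2 ≃ₗ[ℂ] Form 0 := AlternatingMap.constLinearEquivOfIsEmpty

/-- `(X, μ) ↦ (v ↦ ρ(X)(μ(v)))`. -/
def actForm (k : ℕ) : Form k →ₗ[ℂ] SL2 →ₗ[ℂ] Form k :=
  LinearMap.mk₂ ℂ (fun μ X => (rho X).compAlternatingMap μ)
    (by intros; ext; simp) (by intros; ext; simp)
    (by intros; ext; simp) (by intros; ext; simp)

/-- `μ ↦ (X ↦ Σ_j μ(Y₀, …, i[X, Y_j], …, Y_k))`. -/
def bracketForm (k : ℕ) : Form (k + 1) →ₗ[ℂ] SL2 →ₗ[ℂ] Form (k + 1) :=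
  LinearMap.mk₂ ℂ (fun μ X => AlternatingMap.alternatizeUncurryFin (μ.curryLeft ∘ₗ adI X))
    (by intros
        simp only [AlternatingMap.curryLeft_add, LinearMap.add_comp,
          AlternatingMap.alternatizeUncurryFin_add])
    (by intros
        simp only [AlternatingMap.curryLeft_smul, LinearMap.smul_comp,
          AlternatingMap.alternatizeUncurryFin_smul])
    (by intros
        simp only [map_add, LinearMap.comp_add, AlternatingMap.alternatizeUncurryFin_add])
    (by intros
        simp only [map_smul, LinearMap.comp_smul, AlternatingMap.alternatizeUncurryFin_smul])

/-- The Chevalley–Eilenberg differential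
`dμ(X₀, …, X_k) = Σ_i (-1)^i ρ(X_i) μ(…, X̂_i, …)
  + Σ_{i<j} (-1)^{i+j} μ(i[X_i, X_j], …, X̂_i, …, X̂_j, …)`.
The factor `1/2` accounts for the fact that the double alternation in the second summand runs over
ordered pairs `i ≠ j`. -/
def ceD : (k : ℕ) → Form k →ₗ[ℂ] Form (k + 1)
  | 0 => AlternatingMap.alternatizeUncurryFinLM ∘ₗ actForm 0
  | k + 1 => AlternatingMap.alternatizeUncurryFinLM ∘ₗ actForm (k + 1) -
      (1 / 2 : ℂ) • (AlternatingMap.alternatizeUncurryFinLM ∘ₗ bracketForm k)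

lemma ceD_zero_apply (p : M2) (v : Fin 1 → SL2) : ceD 0 (ofM p) v = rho (v 0) p := by
  simp [ceD, AlternatingMap.alternatizeUncurryFin_apply, actForm, ofM]

lemma ceD_one_apply (μ : Form 1) (X Y : SL2) :
    ceD 1 μ ![X, Y] = rho X (μ ![Y]) - rho Y (μ ![X]) - μ ![adI X Y] := by
  have h1 : ∀ w : Fin 1 → SL2, w = ![w 0] := fun w => by ext i; fin_cases i; rfl
  have h2 : adI Y X = (-1 : ℂ) • adI X Y := by
    simp only [adI, LinearMap.mk₂_apply]
    rw [← lie_skew X Y, smul_neg, neg_smul, one_smul, neg_neg]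
  have h3 : μ ![adI Y X] = - μ ![adI X Y] := by
    have := μ.map_update_smul ![adI X Y] 0 (-1) (adI X Y)
    have e : ∀ x y : SL2, Function.update ![x] 0 y = ![y] := fun x y => by
      ext i; fin_cases i; rfl
    rw [e, e] at this
    rw [h2, this, neg_smul, one_smul]
  have h4 : Fin.removeNth 1 ![X, Y] = ![X] := by ext i; fin_cases i; rfl
  have h5 : Fin.tail ![X] = ![] := Subsingleton.elim _ _
  simp [ceD, AlternatingMap.alternatizeUncurryFin_apply, actForm, bracketForm, Fin.sum_univ_two,
    h4, h5, h3]
  module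

/-- The involution `μ^*(X₁, …, X_k) = (μ(X₁^*, …, X_k^*))^*` of `Ω^k(M)`. -/
def starForm (k : ℕ) : Form k →ₗ⋆[ℂ] Form k where
  toFun μ :=
    { toFun := fun v => star (μ (starSL2 ∘ v))
      map_update_add' := by
        intro _ v i x y
        have e : starSL2 (x + y) = starSL2 x + starSL2 y := by
          apply Subtype.ext; simp [starSL2]
        simp only [Function.comp_update, e, AlternatingMap.map_update_add, star_add]
      map_update_smul' := by
        intro _ v i c x
        have e : starSL2 (c • x) = star c • starSL2 x := by
          apply Subtype.ext; simp [starSL2]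
        simp only [Function.comp_update, e, AlternatingMap.map_update_smul, star_smul, star_star]
      map_eq_zero_of_eq' := fun v i j hv hij => by
        rw [μ.map_eq_zero_of_eq _ (congrArg starSL2 hv) hij, star_zero] }
  map_add' := by intros; ext; simp
  map_smul' := by intros; ext; simp

/-- The right module structure `Ω^k(M) × M → Ω^k(M)`. -/
def formMul (k : ℕ) : Form k →ₗ[ℂ] M2 →ₗ[ℂ] Form k :=
  LinearMap.mk₂ ℂ (fun μ p => (LinearMap.mulRight ℂ p).compAlternatingMap μ)
    (by intros; ext; simp) (by intros; ext; simp)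
    (by intros; ext; simp [mul_add]) (by intros; ext; simp)

/-- The left module structure `M × Ω^k(M) → Ω^k(M)`. -/
def mulForm (k : ℕ) : M2 →ₗ[ℂ] Form k →ₗ[ℂ] Form k :=
  LinearMap.mk₂ ℂ (fun p μ => (LinearMap.mulLeft ℂ p).compAlternatingMap μ)
    (by intros; ext; simp [add_mul]) (by intros; ext; simp)
    (by intros; ext; simp) (by intros; ext; simp)

/-- The product `Ω^1(M) × Ω^1(M) → Ω^2(M)`, `(μ ∧ ν)(X, Y) = μ(X) ν(Y) - μ(Y) ν(X)`. -/
def wedge : Form 1 →ₗ[ℂ] Form 1 →ₗ[ℂ] Form 2 :=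
  LinearMap.mk₂ ℂ (fun μ ν => AlternatingMap.alternatizeUncurryFin
      ((mulForm 1).flip ν ∘ₗ (AlternatingMap.ofSubsingleton ℂ SL2 M2 (0 : Fin 1)).symm μ))
    (by intros; ext; simp [AlternatingMap.alternatizeUncurryFin_apply, mulForm,
          Fin.sum_univ_two, AlternatingMap.ofSubsingleton]; abel)
    (by intros; ext; simp [AlternatingMap.alternatizeUncurryFin_apply, mulForm,
          Fin.sum_univ_two, AlternatingMap.ofSubsingleton]; ring)
    (by intros; ext; simp [AlternatingMap.alternatizeUncurryFin_apply, mulForm,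
          Fin.sum_univ_two]; abel)
    (by intros; ext; simp [AlternatingMap.alternatizeUncurryFin_apply, mulForm,
          Fin.sum_univ_two]; ring)

lemma wedge_apply (μ ν : Form 1) (X Y : SL2) :
    wedge μ ν ![X, Y] = μ ![X] * ν ![Y] - μ ![Y] * ν ![X] := by
  have h1 : ∀ X : SL2, (fun _ : Fin 1 => X) = ![X] := fun X => by ext i; fin_cases i; rfl
  have h4 : Fin.removeNth 1 ![X, Y] = ![X] := by ext i; fin_cases i; rfl
  simp [wedge, AlternatingMap.alternatizeUncurryFin_apply, mulForm, Fin.sum_univ_two,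
    AlternatingMap.ofSubsingleton, h1, h4, sub_eq_add_neg]

/-- The left quantum Riemannian metric: `⟨μ̂, μ⟩_L = Σ p̂_{j₁…j_k} p_{j₁…j_k}^*`, the sum over
`j₁ < ⋯ < j_k` of the products of the coefficients `p_{j₁…j_k} = μ(S_{j₁}, …, S_{j_k})` of the
forms in the basis `h^{j₁} ∧ ⋯ ∧ h^{j_k}`. -/
def metricL (k : ℕ) (μ' μ : Form k) : M2 :=
  ∑ j : Fin k → Fin 3 with ∀ a b, a < b → j a < j b,
    μ' (fun a => S (j a)) * star (μ (fun a => S (j a)))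

/-- The right quantum Riemannian metric `⟨μ̂, μ⟩_R = ⟨μ̂^*, μ^*⟩_L`. -/
def metricR (k : ℕ) (μ' μ : Form k) : M2 :=
  metricL k (starForm k μ') (starForm k μ)

/-- `p dvol`, where `dvol = h^0 ∧ h^1 ∧ h^2 · Id` is the quantum volume form. -/
def smulDvol (p : M2) : Form 3 :=
  (LinearMap.toSpanSingleton ℂ M2 p).compAlternatingMap
    (Matrix.detRowAlternating.compLinearMap coord)

/-- The quantum integral `∫_M p dvol = tr(p) / 2`. -/
def integral (μ : Form 3) : ℂ := (1 / 2 : ℂ) * Matrix.trace (μ S)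

lemma integral_smulDvol (p : M2) : integral (smulDvol p) = (1 / 2 : ℂ) * Matrix.trace p := by
  have : (Matrix.of fun i : Fin 3 => coord (S i)) = 1 := by
    ext i j; simp [coord_S, Matrix.one_apply, Pi.single_apply, eq_comm]
  have h2 : Matrix.detRowAlternating (fun i : Fin 3 => coord (S i)) = (1 : ℂ) := by
    change Matrix.det (Matrix.of fun i : Fin 3 => coord (S i)) = 1
    rw [this, Matrix.det_one]
  simp [integral, smulDvol, h2]

/-! ### The group `U(1)` and its differential calculus -/

/-- The `*`-Hopf algebra of `U(1)`: Laurent polynomials in `z = T 1`. -/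
abbrev G : Type := LaurentPolynomial ℂ

/-- The involution of `G` as a ring homomorphism: `(c z^n)^* = c̄ z^{-n}`. -/
def starG : G →+* G :=
  (LaurentPolynomial.invert (R := ℂ)).toRingHom.comp
    (AddMonoidAlgebra.mapRingHom ℤ (starRingEnd ℂ))

lemma starG_algebraMap (c : ℂ) : starG (algebraMap ℂ G c) = algebraMap ℂ G (star c) := by
  rw [LaurentPolynomial.algebraMap_apply, LaurentPolynomial.algebraMap_apply,
    ← LaurentPolynomial.single_eq_C, ← LaurentPolynomial.single_eq_C]
  simp only [starG, RingHom.comp_apply]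
  rw [AddMonoidAlgebra.mapRingHom_single, LaurentPolynomial.single_eq_C]
  exact LaurentPolynomial.invert_C _

lemma starG_T (n : ℤ) : starG (LaurentPolynomial.T n) = LaurentPolynomial.T (-n) := by
  simp only [starG, RingHom.comp_apply, LaurentPolynomial.T]
  rw [AddMonoidAlgebra.mapRingHom_single, map_one]
  exact LaurentPolynomial.invert_T n

/-- The involution of `G` as an antilinear map. -/
def starGₗ : G →ₗ⋆[ℂ] G where
  toFun := starG
  map_add' := map_add _
  map_smul' := by
    intro c g
    rw [Algebra.smul_def, map_mul, starG_algebraMap, ← Algebra.smul_def]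
    rfl

/-- The map `g ↦ κ(g)^*` as a ring homomorphism, `κ` being the antipode. -/
def starAntipode : G →+* G := starG.comp (HopfAlgebra.antipodeAlgHom ℂ G).toRingHom

lemma starAntipode_algebraMap (c : ℂ) :
    starAntipode (algebraMap ℂ G c) = algebraMap ℂ G (star c) := by
  simp only [starAntipode, RingHom.comp_apply, AlgHom.toRingHom_eq_coe, RingHom.coe_coe,
    AlgHom.commutes, starG_algebraMap]

/-- The kernel of the counit. -/
def augIdeal : Ideal G := RingHom.ker (Bialgebra.counitAlgHom ℂ G)

lemma counit_starAntipode (g : G) :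
    Bialgebra.counitAlgHom ℂ G (starAntipode g) = star (Bialgebra.counitAlgHom ℂ G g) := by
  induction g using LaurentPolynomial.induction_on' with
  | add p q hp hq => simp only [map_add, hp, hq, star_add]
  | C_mul_T n a =>
    have hC : LaurentPolynomial.C a = algebraMap ℂ G a := rfl
    rw [map_mul, hC, starAntipode_algebraMap]
    have : starAntipode (LaurentPolynomial.T n) = LaurentPolynomial.T n := by
      change starG (HopfAlgebra.antipode ℂ (LaurentPolynomial.T n : G)) = _
      rw [LaurentPolynomial.antipode_T, starG_T, neg_neg]
    rw [this, map_mul, map_mul, AlgHom.commutes, AlgHom.commutes]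
    simp

lemma starAntipode_mem (g : augIdeal) : starAntipode g ∈ augIdeal := by
  have hg : Bialgebra.counitAlgHom ℂ G (g : G) = 0 := g.2
  change Bialgebra.counitAlgHom ℂ G (starAntipode g) = 0
  rw [counit_starAntipode, hg, star_zero]

/-- The space `invΓ = Ker(ε) / Ker(ε)²` of left-invariant forms. -/
abbrev InvΓ : Type := augIdeal.Cotangent

/-- The quantum germs map `π(g) = [g - ε(g)]`. -/
def germ : G →ₗ[ℂ] InvΓ :=
  augIdeal.toCotangent.restrictScalars ℂ ∘ₗ
    LinearMap.codRestrict (augIdeal.restrictScalars ℂ)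
      (LinearMap.id - Algebra.linearMap ℂ G ∘ₗ (Bialgebra.counitAlgHom ℂ G).toLinearMap)
      (fun g => by
        change Bialgebra.counitAlgHom ℂ G (g - algebraMap ℂ G (Bialgebra.counitAlgHom ℂ G g)) = 0
        rw [map_sub, AlgHom.commutes]
        simp)

/-- The map `g ↦ -κ(g)^*` on `Ker(ε)`, semilinear over the ring homomorphism `g ↦ κ(g)^*`. -/
def starAug : augIdeal →ₛₗ[starAntipode] augIdeal where
  toFun g := -⟨starAntipode g, starAntipode_mem g⟩
  map_add' x y := by ext1; simp [add_comm]
  map_smul' a x := by ext1; simp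

lemma starAug_smul_le : (augIdeal • ⊤ : Submodule G augIdeal) ≤
    (augIdeal • ⊤ : Submodule G augIdeal).comap starAug := by
  rw [Submodule.smul_le]
  intro r hr x _
  rw [Submodule.mem_comap, map_smulₛₗ]
  exact Submodule.smul_mem_smul (starAntipode_mem ⟨r, hr⟩) Submodule.mem_top

/-- The map induced by `starAug` on `Ker(ε) / Ker(ε)²`. -/
def starCotangent : InvΓ →ₛₗ[starAntipode] InvΓ :=
  Submodule.mapQ _ _ starAug starAug_smul_le

/-- The involution of `invΓ`, given by `π(g)^* = -π(κ(g)^*)`. -/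
def starInvΓ : InvΓ →ₗ⋆[ℂ] InvΓ where
  toFun := starCotangent
  map_add' := map_add _
  map_smul' c x := by
    rw [← algebraMap_smul G c x, map_smulₛₗ, starAntipode_algebraMap, algebraMap_smul]
    rfl

lemma starInvΓ_germ (g : G) : starInvΓ (germ g) = - germ (starAntipode g) := by
  change augIdeal.toCotangent _ = - augIdeal.toCotangent _
  rw [← map_neg]
  congr 1
  ext1
  change -starAntipode (g - algebraMap ℂ G (Bialgebra.counitAlgHom ℂ G g)) =
    -(starAntipode g - algebraMap ℂ G (Bialgebra.counitAlgHom ℂ G (starAntipode g)))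
  rw [map_sub, starAntipode_algebraMap, counit_starAntipode]

/-- The basis element `ς = π(z)` of `invΓ`. -/
def varsigma : InvΓ := germ (LaurentPolynomial.T 1)

/-- The adjoint corepresentation `ad(θ) = θ ⊗ 1` of the commutative Hopf algebra `G` on `invΓ`. -/
def ad : InvΓ →ₗ[ℂ] InvΓ ⊗[ℂ] G := (TensorProduct.mk ℂ InvΓ G).flip 1

/-- The embedded differential `δ : invΓ → invΓ ⊗ invΓ`, which is zero for this calculus. -/
def delta : InvΓ →ₗ[ℂ] InvΓ ⊗[ℂ] InvΓ := 0

/-- The `G`-bimodule `Γ = G ⊗ invΓ` of `1`-forms on `U(1)`; `g ⊗ θ` stands for `g θ`. The algebra of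
differential forms of `U(1)` is `Γ^∧ = G ⊕ Γ`, with zero components in all degrees `≥ 2`. -/
abbrev Γ₁ : Type := G ⊗[ℂ] InvΓ

/-- The differential `dg = g⁽¹⁾ π(g⁽²⁾)` of `U(1)`. -/
def dG : G →ₗ[ℂ] Γ₁ := germ.lTensor G ∘ₗ Coalgebra.comul

/-- The left multiplication `G × Γ → Γ`. As `θ ∘ g = ε(g) θ` for `θ` in `invΓ`, it is also the right
multiplication: `θ g = g⁽¹⁾ (θ ∘ g⁽²⁾) = g θ`. -/
def smulΓ : G →ₗ[ℂ] Γ₁ →ₗ[ℂ] Γ₁ := LinearMap.rTensorHom InvΓ ∘ₗ LinearMap.mul ℂ G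

/-- The involution of `Γ`. -/
def starΓ : Γ₁ →ₗ⋆[ℂ] Γ₁ := TensorProduct.map starGₗ starInvΓ

/-- The component `Γ → Γ ⊗ G`, `gθ ↦ (g⁽¹⁾ ⊗ g⁽²⁾) ad(θ)` of the extension of the comultiplication
to `Γ^∧`. -/
def coactΓRight : Γ₁ →ₗ[ℂ] Γ₁ ⊗[ℂ] G :=
  (LinearMap.mul' ℂ G).lTensor Γ₁ ∘ₗ
    (TensorProduct.tensorTensorTensorComm ℂ G G InvΓ G).toLinearMap ∘ₗ
      TensorProduct.map Coalgebra.comul ad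

/-- The component `Γ → G ⊗ Γ`, `gθ ↦ g⁽¹⁾ ⊗ g⁽²⁾θ` of the extension of the comultiplication to
`Γ^∧`. -/
def coactΓLeft : Γ₁ →ₗ[ℂ] G ⊗[ℂ] Γ₁ :=
  (TensorProduct.assoc ℂ G G InvΓ).toLinearMap ∘ₗ (Coalgebra.comul (R := ℂ) (A := G)).rTensor InvΓ

/-! ### The trivial quantum principal `U(1)`-bundle and its differential calculus

The total space is `GM = M ⊗ G`, its calculus is the graded tensor product
`Ω^•(GM) = Ω^•(M) ⊗ Γ^∧`, so that `Ω^{k+1}(GM) = Ω^{k+1}(M) ⊗ G ⊕ Ω^k(M) ⊗ Γ`. -/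

/-- `Ω^0(GM) = GM = M ⊗ G`, with `M` viewed as `Ω^0(M)`. -/
abbrev GM : Type := Form 0 ⊗[ℂ] G

/-- `TotalForm k` is `Ω^{k+1}(GM)`. -/
abbrev TotalForm (k : ℕ) : Type := (Form (k + 1) ⊗[ℂ] G) × (Form k ⊗[ℂ] Γ₁)

/-- The differential `Ω^{k+1}(GM) → Ω^{k+2}(GM)`, `d(μ ⊗ γ) = dμ ⊗ γ + (-1)^{deg μ} μ ⊗ dγ`. -/
def dTotal (k : ℕ) : TotalForm k →ₗ[ℂ] TotalForm (k + 1) :=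
  LinearMap.prod
    ((ceD (k + 1)).rTensor G ∘ₗ LinearMap.fst ℂ _ _)
    ((-1 : ℂ) ^ (k + 1) • dG.lTensor (Form (k + 1)) ∘ₗ LinearMap.fst ℂ _ _ +
      (ceD k).rTensor Γ₁ ∘ₗ LinearMap.snd ℂ _ _)

/-- The product `Ω^1(GM) × Ω^1(GM) → Ω^2(GM)` of the graded tensor product,
`(μ ⊗ γ)(μ' ⊗ γ') = (-1)^{deg γ deg μ'} μ μ' ⊗ γ γ'`. -/
def mulTotal : TotalForm 0 →ₗ[ℂ] TotalForm 0 →ₗ[ℂ] TotalForm 1 :=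
  LinearMap.mk₂ ℂ (fun α β =>
    (TensorProduct.map₂ wedge (LinearMap.mul ℂ G) α.1 β.1,
      TensorProduct.map₂ ((formMul 1).compl₂ ofM.symm.toLinearMap) smulΓ α.1 β.2 -
        TensorProduct.map₂ ((mulForm 1) ∘ₗ ofM.symm.toLinearMap) smulΓ.flip α.2 β.1))
    (by intros; simp; abel) (by intros; simp [smul_sub])
    (by intros; simp; abel) (by intros; simp [smul_sub])

/-- The involution `(μ ⊗ γ)^* = μ^* ⊗ γ^*` of `Ω^{k+1}(GM)`. -/
def starTotal (k : ℕ) : TotalForm k →ₗ⋆[ℂ] TotalForm k where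
  toFun α := (TensorProduct.map (starForm (k + 1)) starGₗ α.1,
    TensorProduct.map (starForm k) starΓ α.2)
  map_add' := by intros; simp
  map_smul' := by intros; ext1 <;> simp [map_smulₛₗ]

/-- The degree one part `Ω^1(GM) → (Ω^•(GM) ⊗ Γ^∧)^1 = Ω^1(GM) ⊗ G ⊕ GM ⊗ Γ` of the extension
`id ⊗ φ` of the coaction of the trivial bundle. -/
def Psi : TotalForm 0 →ₗ[ℂ] (TotalForm 0 ⊗[ℂ] G) × (GM ⊗[ℂ] Γ₁) :=
  LinearMap.coprod
    (LinearMap.inl ℂ _ _ ∘ₗ (LinearMap.inl ℂ (Form 1 ⊗[ℂ] G) (Form 0 ⊗[ℂ] Γ₁)).rTensor G ∘ₗ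
      (TensorProduct.assoc ℂ (Form 1) G G).symm.toLinearMap ∘ₗ
        (Coalgebra.comul (R := ℂ) (A := G)).lTensor (Form 1))
    (LinearMap.prod
      ((LinearMap.inr ℂ (Form 1 ⊗[ℂ] G) (Form 0 ⊗[ℂ] Γ₁)).rTensor G ∘ₗ
        (TensorProduct.assoc ℂ (Form 0) Γ₁ G).symm.toLinearMap ∘ₗ coactΓRight.lTensor (Form 0))
      ((TensorProduct.assoc ℂ (Form 0) G Γ₁).symm.toLinearMap ∘ₗ coactΓLeft.lTensor (Form 0)))

/-- The inclusion `μ ↦ μ ⊗ 1` of `Ω^{k+1}(M)` into `Ω^{k+1}(GM)`. -/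
def ofBase (k : ℕ) : Form (k + 1) →ₗ[ℂ] TotalForm k :=
  LinearMap.inl ℂ _ _ ∘ₗ (TensorProduct.mk ℂ (Form (k + 1)) G).flip 1

/-- The retraction `id ⊗ ε` of `Ω^{k+1}(GM)` onto `Ω^{k+1}(M)`; on the base forms `μ ⊗ 1` it is the
inverse of `ofBase`. -/
def toBase (k : ℕ) : TotalForm k →ₗ[ℂ] Form (k + 1) :=
  (TensorProduct.rid ℂ (Form (k + 1))).toLinearMap ∘ₗ
    (Coalgebra.counit (R := ℂ) (A := G)).lTensor (Form (k + 1)) ∘ₗ LinearMap.fst ℂ _ _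

lemma toBase_ofBase (k : ℕ) (μ : Form (k + 1)) : toBase k (ofBase k μ) = μ := by
  simp [toBase, ofBase]

/-! ### Quantum principal connections -/

/-- A quantum principal connection: a linear map `ω : invΓ → Ω^1(GM)` with
`Ψ(ω(θ)) = (ω ⊗ id)ad(θ) + 1 ⊗ θ`. -/
def IsQPC (ω : InvΓ →ₗ[ℂ] TotalForm 0) : Prop :=
  ∀ θ, Psi (ω θ) = (ω.rTensor G (ad θ), 0) + (0, (ofM 1 ⊗ₜ 1) ⊗ₜ (1 ⊗ₜ θ))

/-- A quantum connection displacement: a linear map `lam : invΓ → Hor^1(GM)` with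
`Ψ(lam(θ)) = (lam ⊗ id)ad(θ)`. -/
def IsDisplacement (lam : InvΓ →ₗ[ℂ] TotalForm 0) : Prop :=
  ∀ θ, Psi (lam θ) = (lam.rTensor G (ad θ), 0)

/-- The trivial connection `θ ↦ 1 ⊗ θ`. -/
def omegaTriv : InvΓ →ₗ[ℂ] TotalForm 0 :=
  LinearMap.inr ℂ _ _ ∘ₗ TensorProduct.mk ℂ (Form 0) Γ₁ (ofM 1) ∘ₗ TensorProduct.mk ℂ G InvΓ 1

/-- For a linear map `B : invΓ → Ω^{k+1}(M)`, the map `(B ⊗ id) ∘ ad : invΓ → Ω^{k+1}(GM)`. -/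
def tensorAd (k : ℕ) (B : InvΓ →ₗ[ℂ] Form (k + 1)) : InvΓ →ₗ[ℂ] TotalForm k :=
  LinearMap.inl ℂ _ _ ∘ₗ B.rTensor G ∘ₗ ad

/-- `A` is the non-commutative gauge potential of `ω`: `ω = ω^triv + (A ⊗ id) ∘ ad`. -/
def IsGaugePotential (ω : InvΓ →ₗ[ℂ] TotalForm 0) (A : InvΓ →ₗ[ℂ] Form 1) : Prop :=
  ω = omegaTriv + tensorAd 0 A

/-- The curvature `R^ω = d ∘ ω - ⟨ω, ω⟩`, `⟨ω, ω⟩ = m ∘ (ω ⊗ ω) ∘ δ`. -/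
def curvature (ω : InvΓ →ₗ[ℂ] TotalForm 0) : InvΓ →ₗ[ℂ] TotalForm 1 :=
  dTotal 0 ∘ₗ ω - TensorProduct.lift mulTotal ∘ₗ TensorProduct.map ω ω ∘ₗ delta

/-- A connection is flat if its curvature vanishes. -/
def IsFlat (ω : InvΓ →ₗ[ℂ] TotalForm 0) : Prop := curvature ω = 0

/-- The field strength `F = d ∘ A - ⟨A, A⟩` of a gauge potential. -/
def fieldStrength (A : InvΓ →ₗ[ℂ] Form 1) : InvΓ →ₗ[ℂ] Form 2 :=
  ceD 1 ∘ₗ A - TensorProduct.lift wedge ∘ₗ TensorProduct.map A A ∘ₗ delta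

/-- `τ̂ = * ∘ τ ∘ *`. -/
def hat (k : ℕ) (τ : InvΓ →ₗ[ℂ] TotalForm k) : InvΓ →ₗ[ℂ] TotalForm k :=
  starTotal k ∘ₛₗ τ ∘ₛₗ starInvΓ

/-! ### The Yang–Mills functional

`invΓ` has the orthonormal basis `{ς}` and `ad` is trivial, so the left and right `M`-modules
`Mor(ad, Φ)` are free on `T(ς) = 1`, with `T(ς) T(ς)^* = T(ς)^* T(ς) = 1`. Hence a map `τ` in
`Mor(ad, Φ_H)` of degree `k + 1` corresponds to `τ(ς) ⊗_M T`, resp. `T ⊗_M τ(ς)`, with `τ(ς)` a base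
form, and the hermitian structures of vector bundle valued forms are the following. -/

/-- `⟨τ', τ⟩_L`. -/
def hermL (k : ℕ) (τ' τ : InvΓ →ₗ[ℂ] TotalForm k) : M2 :=
  metricL (k + 1) (toBase k (τ' varsigma)) (toBase k (τ varsigma))

/-- `⟨τ', τ⟩_R`. -/
def hermR (k : ℕ) (τ' τ : InvΓ →ₗ[ℂ] TotalForm k) : M2 :=
  metricR (k + 1) (toBase k (τ' varsigma)) (toBase k (τ varsigma))

/-- The Yang–Mills Lagrangian `-(⟨R^ω, R^ω⟩_L + ⟨R̂^ω, R̂^ω⟩_R) / 4`. -/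
def lagrangianYM (ω : InvΓ →ₗ[ℂ] TotalForm 0) : M2 :=
  -(1 / 4 : ℂ) • (hermL 1 (curvature ω) (curvature ω) +
    hermR 1 (hat 1 (curvature ω)) (hat 1 (curvature ω)))

/-- The Yang–Mills action `∫_M L_YM(ω) dvol`. -/
def actionYM (ω : InvΓ →ₗ[ℂ] TotalForm 0) : ℂ := integral (smulDvol (lagrangianYM ω))

/-- The derivative `∂f/∂z = (∂f/∂x - i ∂f/∂y) / 2` of a real differentiable function of a complex
variable `z = x + iy`. -/
def wirtinger (f : ℂ → ℂ) (z : ℂ) : ℂ :=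
  (1 / 2 : ℂ) * (fderiv ℝ f z 1 - Complex.I * fderiv ℝ f z Complex.I)

/-- Yang–Mills connections: stationary points of the Yang–Mills action on the affine space of quantum
principal connections. -/
def IsYangMills (ω : InvΓ →ₗ[ℂ] TotalForm 0) : Prop :=
  IsQPC ω ∧ ∀ lam : InvΓ →ₗ[ℂ] TotalForm 0, IsDisplacement lam →
    DifferentiableAt ℝ (fun z : ℂ => actionYM (ω + z • lam)) 0 ∧
      wirtinger (fun z : ℂ => actionYM (ω + z • lam)) 0 = 0

end NCYM

end

namespace NCYM

/-! ### Forms are determined by their values on the basis `S` -/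

/-! Since $\delta = 0$, the quadratic term of the curvature disappears and $R^\omega = d\circ\omega$
is linear. A qpc has the form $\omega^{\mathrm{triv}} + A\otimes 1$ (`IsQPC.isGaugePotential`), and
$d\omega^{\mathrm{triv}} = 0$, so its curvature is $dA\otimes 1$ (`curvature_omegaTriv_add`). With
$F = dA(\varsigma)$, the left and right halves of the Lagrangian agree, and the action is
$-\frac14\sum_{i<j}\mathrm{tr}(F_{ij}F_{ij}^*)$ (`actionYM_eq`), a negative definite hermitian form
in $F$.

The displacement $\lambda = A\otimes 1$ is a sufficient test direction: $\omega + z\lambda$ has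
potential $(1+z)A$, so the action is multiplied by $|1+z|^2$ (`actionYM_add_smul`). The Wirtinger
derivative at $0$ is therefore the action itself (`wirtinger_mul_normSq`). Stationarity makes the
action vanish, and definiteness (`eq_zero_of_trace_metricL_eq_zero`) gives $F = 0$. As $\varsigma$
spans `InvΓ`, the connection is flat.

Exactness of $A(\varsigma)$ is then the vanishing of the first cohomology (`ker_ceD_one`), an
instance of Whitehead's lemma. Here it is obtained from an explicit primitive (`exists_rho_S_eq`).
-/

lemma sum_coord_smul_S (B : SL2) : ∑ j, coord B j • S j = B := by
  have h : (B : M2) 0 0 + (B : M2) 1 1 = 0 := by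
    have h0 : Matrix.trace (B : M2) = 0 := B.2
    rwa [Matrix.trace_fin_two] at h0
  have h' : (B : M2) 1 1 = -(B : M2) 0 0 := by linear_combination h
  apply Subtype.ext
  ext i j
  fin_cases i <;> fin_cases j <;>
    simp [coord, S, pauli, Fin.sum_univ_three, Matrix.trace_fin_two, Matrix.mul_apply,
      Fin.sum_univ_two, h'] <;> ring_nf <;> simp <;> ring

/-- The elements `S_j` form a basis of `sl(2,ℂ)`. -/
noncomputable def basisS : Module.Basis (Fin 3) ℂ SL2 :=
  Module.Basis.ofEquivFun
    { coord with
      invFun := fun c => ∑ j, c j • S j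
      left_inv := sum_coord_smul_S
      right_inv := fun c => by
        change coord (∑ j, c j • S j) = c
        simp only [map_sum, map_smul, coord_S]
        ext i
        simp [Finset.sum_apply, Pi.single_apply] }

lemma basisS_apply (j : Fin 3) : basisS j = S j := by
  simp [basisS, Module.Basis.coe_ofEquivFun, Pi.single_apply]

lemma form_one_ext {μ ν : Form 1} (h : ∀ j, μ ![S j] = ν ![S j]) : μ = ν := by
  refine basisS.ext_alternating fun v _ => ?_
  have e : (fun i => basisS (v i)) = ![S (v 0)] := by
    ext1 i; fin_cases i; simp [basisS_apply]
  rw [e, h]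

lemma form_two_ext {μ ν : Form 2}
    (h : ∀ i j : Fin 3, i < j → μ ![S i, S j] = ν ![S i, S j]) : μ = ν := by
  refine basisS.ext_alternating fun v hv => ?_
  have e : (fun i => basisS (v i)) = ![S (v 0), S (v 1)] := by
    ext1 i; fin_cases i <;> simp [basisS_apply]
  have hne : v 0 ≠ v 1 := fun hh => absurd (hv hh) (by decide)
  rw [e]
  rcases lt_or_gt_of_ne hne with hlt | hgt
  · exact h _ _ hlt
  · have sw : ∀ X Y : SL2, ![X, Y] = ![Y, X] ∘ Equiv.swap 0 1 := fun X Y => by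
      ext1 i; fin_cases i <;> simp
    rw [sw, AlternatingMap.map_perm, AlternatingMap.map_perm, h _ _ hgt]

/-! ### The first cohomology -/

lemma coe_adI (X Y : SL2) :
    (adI X Y : M2) = Complex.I • ((X : M2) * (Y : M2) - (Y : M2) * (X : M2)) := rfl

lemma rho_apply (X : SL2) (p : M2) :
    rho X p = Complex.I • ((X : M2) * p - p * (X : M2)) := rfl

/-- This is the statement that `rho` is a representation for the bracket $i[\cdot,\cdot]$:
$[\rho(X),\rho(Y)] = \rho(i[X,Y])$. -/
lemma ceD_one_ceD_zero (p : M2) : ceD 1 (ceD 0 (ofM p)) = 0 := by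
  refine form_two_ext fun i j _ => ?_
  rw [ceD_one_apply]
  simp only [ceD_zero_apply, Matrix.cons_val_zero, AlternatingMap.zero_apply, rho_apply, coe_adI]
  simp only [smul_sub, mul_sub, sub_mul, mul_smul_comm, smul_mul_assoc, mul_assoc, smul_smul]
  abel

lemma adI_S_zero_one : adI (S 0) (S 1) = -S 2 := by
  apply Subtype.ext
  ext i j
  fin_cases i <;> fin_cases j <;> simp [coe_adI, S, pauli] <;> ring_nf <;> simp <;> ring

lemma adI_S_zero_two : adI (S 0) (S 2) = S 1 := by
  apply Subtype.ext
  ext i j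
  fin_cases i <;> fin_cases j <;> simp [coe_adI, S, pauli] <;> ring_nf

lemma adI_S_one_two : adI (S 1) (S 2) = -S 0 := by
  apply Subtype.ext
  ext i j
  fin_cases i <;> fin_cases j <;> simp [coe_adI, S, pauli] <;> ring_nf <;> simp <;> ring

lemma exists_rho_S_eq (a b c : M2)
    (h01 : rho (S 0) b - rho (S 1) a = -c)
    (h02 : rho (S 0) c - rho (S 2) a = b)
    (h12 : rho (S 1) c - rho (S 2) b = -a) :
    ∃ p : M2, rho (S 0) p = a ∧ rho (S 1) p = b ∧ rho (S 2) p = c := by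
  have hI : Complex.I * Complex.I = -1 := Complex.I_mul_I
  -- The off-diagonal entries solve $i[S_2,p] = c$. Entry $(0,1)$ of $i[S_0,p] = a$ reads $\frac
  -- i2(p_{11}-p_{00}) = a_{01}$. Scalar matrices are killed by every $\rho(X)$, so $p_{00} = 0$ is
  -- a free normalization. The remaining entries follow from the cocycle equations.
  refine ⟨!![0, -Complex.I * c 0 1; Complex.I * c 1 0, -2 * Complex.I * a 0 1], ?_⟩
  simp only [← Matrix.ext_iff, Fin.forall_fin_two] at h01 h02 h12 ⊢
  simp only [rho_apply, Matrix.smul_apply, Matrix.sub_apply, Matrix.neg_apply, Matrix.mul_apply,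
    Fin.sum_univ_two] at h01 h02 h12 ⊢
  simp [S, pauli] at h01 h02 h12 ⊢
  obtain ⟨⟨h1, h2⟩, h3, h4⟩ := h01
  obtain ⟨⟨h5, h6⟩, h7, h8⟩ := h02
  obtain ⟨⟨h9, h10⟩, h11, h12⟩ := h12
  refine ⟨⟨⟨?_, ?_⟩, ?_, ?_⟩, ⟨⟨?_, ?_⟩, ?_, ?_⟩, ⟨?_, ?_⟩, ?_, ?_⟩
  all_goals grind

lemma ker_ceD_one : LinearMap.ker (ceD 1) = LinearMap.range (ceD 0) := by
  apply le_antisymm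
  · intro μ hμ
    have hμ : ceD 1 μ = 0 := hμ
    have neg : ∀ X : SL2, μ ![-X] = -μ ![X] := fun X => by
      have := μ.map_update_neg ![X] 0 X
      have e : ∀ x y : SL2, Function.update ![x] 0 y = ![y] := fun x y => by
        ext1 i; fin_cases i; rfl
      rwa [e, e] at this
    have key : ∀ X Y : SL2, rho X (μ ![Y]) - rho Y (μ ![X]) = μ ![adI X Y] := fun X Y => by
      rw [← sub_eq_zero, ← ceD_one_apply, hμ, AlternatingMap.zero_apply]
    obtain ⟨p, h0, h1, h2⟩ := exists_rho_S_eq (μ ![S 0]) (μ ![S 1]) (μ ![S 2])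
      (by rw [key, adI_S_zero_one, neg]) (by rw [key, adI_S_zero_two])
      (by rw [key, adI_S_one_two, neg])
    refine ⟨ofM p, form_one_ext fun j => ?_⟩
    rw [ceD_zero_apply, Matrix.cons_val_zero]
    fin_cases j
    exacts [h0, h1, h2]
  · rintro _ ⟨f, rfl⟩
    obtain ⟨p, rfl⟩ := ofM.surjective f
    exact ceD_one_ceD_zero p

/-! ### The invariant forms of `U(1)` -/

lemma germ_one : germ 1 = 0 := by
  change augIdeal.toCotangent _ = 0
  rw [← map_zero augIdeal.toCotangent]
  congr 1
  ext1
  change (1 : G) - algebraMap ℂ G (Bialgebra.counitAlgHom ℂ G 1) = 0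
  rw [map_one, map_one, sub_self]

/-- $\pi$ is an $\epsilon$-derivation because $(g-\epsilon(g))(h-\epsilon(h))$ lies in
$\mathrm{Ker}(\epsilon)^2$. -/
lemma germ_mul (g h : G) :
    germ (g * h) = Bialgebra.counitAlgHom ℂ G g • germ h + Bialgebra.counitAlgHom ℂ G h • germ g := by
  have key : ∀ x : augIdeal, ((x : G) ∈ augIdeal ^ 2) → augIdeal.toCotangent x = 0 :=
    fun x hx => (augIdeal.toCotangent_eq_zero x).2 hx
  set e := Bialgebra.counitAlgHom ℂ G
  have hmem : ∀ g : G, g - algebraMap ℂ G (e g) ∈ augIdeal := fun g => by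
    change e (g - algebraMap ℂ G (e g)) = 0
    rw [map_sub, AlgHom.commutes]
    simp
  have hg : ∀ g : G, germ g = augIdeal.toCotangent ⟨_, hmem g⟩ := fun g => rfl
  rw [← sub_eq_zero, hg, hg, hg, ← algebraMap_smul G (e g), ← algebraMap_smul G (e h), ← map_smul,
    ← map_smul, ← map_add, ← map_sub]
  apply key
  have : (g - algebraMap ℂ G (e g)) * (h - algebraMap ℂ G (e h)) ∈ augIdeal ^ 2 := by
    rw [pow_two]; exact Ideal.mul_mem_mul (hmem g) (hmem h)
  convert this using 1
  simp only [AddSubgroupClass.coe_sub, Submodule.coe_add, Submodule.coe_smul, smul_eq_mul, map_mul]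
  ring

lemma counit_T (n : ℤ) : Bialgebra.counitAlgHom ℂ G (LaurentPolynomial.T n) = 1 := by
  simp

lemma germ_T (n : ℤ) : germ (LaurentPolynomial.T n) = (n : ℂ) • varsigma := by
  have step : ∀ m : ℤ, germ (LaurentPolynomial.T (m + 1)) =
      varsigma + germ (LaurentPolynomial.T m) := fun m => by
    rw [LaurentPolynomial.T_add, germ_mul, counit_T, counit_T, one_smul, one_smul]
    rfl
  induction n using Int.induction_on with
  | zero => simpa using germ_one
  | succ i ih =>
    rw [step, ih]; push_cast; module
  | pred i ih =>
    have := step (-(i : ℤ) - 1)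
    rw [sub_add_cancel, ih] at this
    rw [← add_right_inj varsigma, ← this]; push_cast; module

lemma germ_mem_span (g : G) : germ g ∈ Submodule.span ℂ {varsigma} := by
  induction g using LaurentPolynomial.induction_on' with
  | add p q hp hq => rw [map_add]; exact add_mem hp hq
  | C_mul_T n a =>
    have hC : LaurentPolynomial.C a = algebraMap ℂ G a := rfl
    rw [hC, ← Algebra.smul_def, map_smul, germ_T]
    exact Submodule.smul_mem _ _ (Submodule.smul_mem _ _ (Submodule.mem_span_singleton_self _))

lemma germ_surjective : Function.Surjective germ := fun x => by
  obtain ⟨g, rfl⟩ := augIdeal.toCotangent_surjective x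
  refine ⟨g, ?_⟩
  change augIdeal.toCotangent _ = _
  congr 1
  ext1
  have hg : Bialgebra.counitAlgHom ℂ G (g : G) = 0 := g.2
  change (g : G) - algebraMap ℂ G (Bialgebra.counitAlgHom ℂ G (g : G)) = g
  rw [hg, map_zero, sub_zero]

/-- Every class is a germ and every germ is a multiple of `varsigma`, so `InvΓ` is spanned by this
one element. -/
lemma invΓ_hom_ext {V : Type*} [AddCommGroup V] [Module ℂ V] {f g : InvΓ →ₗ[ℂ] V}
    (h : f varsigma = g varsigma) : f = g := by
  ext x
  obtain ⟨y, rfl⟩ := germ_surjective x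
  obtain ⟨c, hc⟩ := Submodule.mem_span_singleton.1 (germ_mem_span y)
  rw [← hc, map_smul, map_smul, h]

lemma starInvΓ_varsigma : starInvΓ varsigma = -varsigma := by
  have : starAntipode (LaurentPolynomial.T 1) = LaurentPolynomial.T 1 := by
    change starG (HopfAlgebra.antipode ℂ (LaurentPolynomial.T 1 : G)) = _
    rw [LaurentPolynomial.antipode_T, starG_T, neg_neg]
  rw [varsigma, starInvΓ_germ, this]

lemma dG_one : dG 1 = 0 := by
  simp [dG, Bialgebra.comul_one, Algebra.TensorProduct.one_def, germ_one]

/-! ### Connections and their gauge potentials -/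

lemma ofBase_apply (k : ℕ) (μ : Form (k + 1)) : ofBase k μ = (μ ⊗ₜ 1, 0) := rfl

lemma tensorAd_apply (k : ℕ) (B : InvΓ →ₗ[ℂ] Form (k + 1)) (θ : InvΓ) :
    tensorAd k B θ = ofBase k (B θ) := rfl

lemma omegaTriv_apply (θ : InvΓ) : omegaTriv θ = (0, ofM 1 ⊗ₜ (1 ⊗ₜ θ)) := rfl

lemma toBase_omegaTriv (θ : InvΓ) : toBase 0 (omegaTriv θ) = 0 := by
  simp [toBase, omegaTriv_apply]

lemma isDisplacement_tensorAd (B : InvΓ →ₗ[ℂ] Form 1) : IsDisplacement (tensorAd 0 B) := by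
  intro θ
  simp [Psi, tensorAd, ad, Bialgebra.comul_one, Algebra.TensorProduct.one_def]

/-- Apply $\mathrm{id}\otimes\epsilon\otimes\mathrm{id}$ to the coinvariance identity: by the counit
axiom the left side becomes `a`, and the right side is already of the form $v\otimes 1$. -/
lemma eq_tmul_one_of_coinvariant {V : Type*} [AddCommGroup V] [Module ℂ V] (a : V ⊗[ℂ] G)
    (h : (TensorProduct.assoc ℂ V G G).symm
      ((Coalgebra.comul (R := ℂ) (A := G)).lTensor V a) = a ⊗ₜ 1) :
    a = (TensorProduct.rid ℂ V ((Coalgebra.counit (R := ℂ) (A := G)).lTensor V a)) ⊗ₜ 1 := by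
  have h1 := congrArg (TensorProduct.map ((TensorProduct.rid ℂ V).toLinearMap ∘ₗ
      (Coalgebra.counit (R := ℂ) (A := G)).lTensor V) (LinearMap.id : G →ₗ[ℂ] G)) h
  have h2 : TensorProduct.map ((TensorProduct.rid ℂ V).toLinearMap ∘ₗ
      (Coalgebra.counit (R := ℂ) (A := G)).lTensor V) (LinearMap.id : G →ₗ[ℂ] G) ∘ₗ
      (TensorProduct.assoc ℂ V G G).symm.toLinearMap ∘ₗ
      (Coalgebra.comul (R := ℂ) (A := G)).lTensor V = LinearMap.id := by
    have h3 : (TensorProduct.map ((TensorProduct.rid ℂ V).toLinearMap ∘ₗ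
      (Coalgebra.counit (R := ℂ) (A := G)).lTensor V) (LinearMap.id : G →ₗ[ℂ] G)) ∘ₗ
      (TensorProduct.assoc ℂ V G G).symm.toLinearMap =
      ((TensorProduct.lid ℂ G).toLinearMap ∘ₗ
        (Coalgebra.counit (R := ℂ) (A := G)).rTensor G).lTensor V := by
      ext; simp
    rw [← LinearMap.comp_assoc, h3, ← LinearMap.lTensor_comp, LinearMap.comp_assoc,
      Coalgebra.rTensor_counit_comp_comul]
    ext; simp
  rw [TensorProduct.map_tmul] at h1
  exact (LinearMap.congr_fun h2 a).symm.trans h1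

/-- The same counit argument, now for the component of the coaction with values in $G\otimes\Gamma$;
it recovers the vertical part of a connection. -/
lemma eq_of_coactΓLeft {V : Type*} [AddCommGroup V] [Module ℂ V] (b : V ⊗[ℂ] Γ₁) (v : V)
    (θ : InvΓ)
    (h : (TensorProduct.assoc ℂ V G Γ₁).symm (coactΓLeft.lTensor V b) =
      (v ⊗ₜ 1) ⊗ₜ (1 ⊗ₜ θ)) : b = v ⊗ₜ (1 ⊗ₜ θ) := by
  have h1 := congrArg (TensorProduct.map ((TensorProduct.rid ℂ V).toLinearMap ∘ₗ
      (Coalgebra.counit (R := ℂ) (A := G)).lTensor V) (LinearMap.id : Γ₁ →ₗ[ℂ] Γ₁)) h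
  have h3 : (TensorProduct.map ((TensorProduct.rid ℂ V).toLinearMap ∘ₗ
      (Coalgebra.counit (R := ℂ) (A := G)).lTensor V) (LinearMap.id : Γ₁ →ₗ[ℂ] Γ₁)) ∘ₗ
      (TensorProduct.assoc ℂ V G Γ₁).symm.toLinearMap =
      ((TensorProduct.lid ℂ Γ₁).toLinearMap ∘ₗ
        (Coalgebra.counit (R := ℂ) (A := G)).rTensor Γ₁).lTensor V := by
    ext; simp
  have h4 : ((TensorProduct.lid ℂ Γ₁).toLinearMap ∘ₗ
        (Coalgebra.counit (R := ℂ) (A := G)).rTensor Γ₁) ∘ₗ coactΓLeft = LinearMap.id := by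
    have h5 : ((TensorProduct.lid ℂ Γ₁).toLinearMap ∘ₗ
        (Coalgebra.counit (R := ℂ) (A := G)).rTensor Γ₁) ∘ₗ
        (TensorProduct.assoc ℂ G G InvΓ).toLinearMap =
        ((TensorProduct.lid ℂ G).toLinearMap ∘ₗ
          (Coalgebra.counit (R := ℂ) (A := G)).rTensor G).rTensor InvΓ := by
      ext; simp
    rw [coactΓLeft, ← LinearMap.comp_assoc, h5, ← LinearMap.rTensor_comp, LinearMap.comp_assoc,
      Coalgebra.rTensor_counit_comp_comul]
    ext; simp
  have h2 : TensorProduct.map ((TensorProduct.rid ℂ V).toLinearMap ∘ₗ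
      (Coalgebra.counit (R := ℂ) (A := G)).lTensor V) (LinearMap.id : Γ₁ →ₗ[ℂ] Γ₁) ∘ₗ
      (TensorProduct.assoc ℂ V G Γ₁).symm.toLinearMap ∘ₗ coactΓLeft.lTensor V = LinearMap.id := by
    rw [← LinearMap.comp_assoc, h3, ← LinearMap.lTensor_comp, h4, LinearMap.lTensor_id]
  rw [TensorProduct.map_tmul] at h1
  refine (LinearMap.congr_fun h2 b).symm.trans (h1.trans ?_)
  simp

lemma IsQPC.isGaugePotential {ω : InvΓ →ₗ[ℂ] TotalForm 0} (h : IsQPC ω) :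
    IsGaugePotential ω (toBase 0 ∘ₗ ω) := by
  refine LinearMap.ext fun θ => ?_
  have hθ := h θ
  -- Projecting to $\Omega^1(M)\otimes G\otimes G$ discards the contribution of the vertical part,
  -- which leaves coinvariance of the horizontal part. The $GM\otimes\Gamma$ component used next
  -- sees only the vertical part.
  have h1 := congrArg (fun x => (LinearMap.fst ℂ (Form 1 ⊗[ℂ] G) (Form 0 ⊗[ℂ] Γ₁)).rTensor G x.1) hθ
  have h2 := congrArg Prod.snd hθ
  simp only [Psi, LinearMap.coprod_apply, LinearMap.comp_apply, LinearMap.inl_apply,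
    LinearMap.prod_apply, Function.prod_apply, Prod.fst_add, Prod.snd_add, zero_add, add_zero, map_add,
    ← LinearMap.rTensor_comp_apply, LinearMap.fst_comp_inl, LinearMap.fst_comp_inr,
    LinearMap.rTensor_zero, LinearMap.zero_apply, LinearMap.rTensor_id, LinearMap.id_apply, ad,
    LinearMap.flip_apply, TensorProduct.mk_apply, LinearMap.rTensor_tmul] at h1 h2
  have e1 := eq_tmul_one_of_coinvariant _ h1
  have e2 := eq_of_coactΓLeft _ _ _ h2
  exact Prod.ext (e1.trans (zero_add _).symm) (e2.trans (add_zero _).symm)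

/-- Uniqueness of the potential: $\mathrm{id}\otimes\epsilon$ on the horizontal part kills
$\omega^{\mathrm{triv}}$ and inverts $\mu\mapsto\mu\otimes 1$. -/
lemma IsGaugePotential.eq_toBase {ω : InvΓ →ₗ[ℂ] TotalForm 0} {A : InvΓ →ₗ[ℂ] Form 1}
    (h : IsGaugePotential ω A) : A = toBase 0 ∘ₗ ω := by
  ext1 θ
  rw [LinearMap.comp_apply, h, LinearMap.add_apply, map_add, toBase_omegaTriv, zero_add,
    tensorAd_apply, toBase_ofBase]

lemma ceD_zero_ofM_one : ceD 0 (ofM 1) = 0 := by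
  ext1 v
  rw [ceD_zero_apply]
  simp [rho]

lemma fieldStrength_eq (A : InvΓ →ₗ[ℂ] Form 1) : fieldStrength A = ceD 1 ∘ₗ A := by
  simp [fieldStrength, delta]

lemma curvature_eq (ω : InvΓ →ₗ[ℂ] TotalForm 0) : curvature ω = dTotal 0 ∘ₗ ω := by
  simp [curvature, delta]

lemma curvature_omegaTriv_add (A : InvΓ →ₗ[ℂ] Form 1) :
    curvature (omegaTriv + tensorAd 0 A) = tensorAd 1 (fieldStrength A) := by
  ext1 θ
  rw [curvature_eq, fieldStrength_eq, LinearMap.comp_apply, LinearMap.add_apply, tensorAd_apply,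
    tensorAd_apply, ofBase_apply, ofBase_apply, omegaTriv_apply]
  simp [dTotal, dG_one, ceD_zero_ofM_one]

lemma starForm_starForm (k : ℕ) (μ : Form k) : starForm k (starForm k μ) = μ := by
  ext1 v
  have : starSL2 ∘ starSL2 ∘ v = v := by
    ext1 i; apply Subtype.ext; simp [starSL2]
  change star (star (μ (starSL2 ∘ starSL2 ∘ v))) = μ v
  rw [star_star, this]

lemma starTotal_ofBase (k : ℕ) (μ : Form (k + 1)) :
    starTotal k (ofBase k μ) = ofBase k (starForm (k + 1) μ) := by
  simp [starTotal, ofBase_apply, starGₗ]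

lemma lagrangianYM_eq (A : InvΓ →ₗ[ℂ] Form 1) :
    lagrangianYM (omegaTriv + tensorAd 0 A) =
      -(1 / 2 : ℂ) • metricL 2 (ceD 1 (A varsigma)) (ceD 1 (A varsigma)) := by
  have h1 : toBase 1 (tensorAd 1 (fieldStrength A) varsigma) = ceD 1 (A varsigma) := by
    rw [tensorAd_apply, toBase_ofBase, fieldStrength_eq, LinearMap.comp_apply]
  -- The star in `metricR` cancels the outer star of `hat`. The inner one leaves a sign, because
  -- $\varsigma^* = -\varsigma$; the hermitian square does not see it.
  have h2 : starForm 2 (toBase 1 (hat 1 (tensorAd 1 (fieldStrength A)) varsigma)) =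
      -ceD 1 (A varsigma) := by
    rw [hat, LinearMap.comp_apply, LinearMap.comp_apply, starInvΓ_varsigma, map_neg,
      tensorAd_apply, fieldStrength_eq, LinearMap.comp_apply, map_neg, starTotal_ofBase, map_neg,
      toBase_ofBase, map_neg, starForm_starForm]
  have h3 : ∀ F : Form 2, metricL 2 (-F) (-F) = metricL 2 F F := fun F => by simp [metricL]
  rw [lagrangianYM, hermL, hermR, metricR, curvature_omegaTriv_add, h1, h2, h3]
  module

/-! ### The Yang–Mills action -/

lemma metricL_smul_smul (k : ℕ) (c : ℂ) (μ : Form k) :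
    metricL k (c • μ) (c • μ) = (c * star c) • metricL k μ μ := by
  simp only [metricL, AlternatingMap.smul_apply, star_smul, smul_mul_smul_comm, Finset.smul_sum]

open scoped ComplexOrder in
-- The trace is a sum of the nonnegative numbers $\mathrm{tr}(F_{ij}F_{ij}^*)$ over $i<j$, so each
-- of them vanishes, and then so does each $F_{ij}$.
lemma eq_zero_of_trace_metricL_eq_zero {F : Form 2} (h : Matrix.trace (metricL 2 F F) = 0) :
    F = 0 := by
  simp only [metricL, Matrix.trace_sum, Matrix.star_eq_conjTranspose] at h
  rw [Finset.sum_eq_zero_iff_of_nonneg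
    fun j _ => (Matrix.posSemidef_self_mul_conjTranspose _).trace_nonneg] at h
  refine form_two_ext fun i j hij => ?_
  have e : (fun a => S (![i, j] a)) = ![S i, S j] := by
    ext1 a; fin_cases a <;> rfl
  have := h ![i, j] (by
    rw [Finset.mem_filter]
    refine ⟨Finset.mem_univ _, fun a b hab => ?_⟩
    fin_cases a <;> fin_cases b <;> first | exact hij | exact absurd hab (by decide))
  rw [e] at this
  exact Matrix.trace_mul_conjTranspose_self_eq_zero_iff.1 this

lemma actionYM_eq (A : InvΓ →ₗ[ℂ] Form 1) :
    actionYM (omegaTriv + tensorAd 0 A) =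
      -(1 / 4 : ℂ) * Matrix.trace (metricL 2 (ceD 1 (A varsigma)) (ceD 1 (A varsigma))) := by
  rw [actionYM, integral_smulDvol, lagrangianYM_eq, Matrix.trace_smul, smul_eq_mul]
  ring

/-- Moving along the potential itself only rescales it to $(1+z)A$, and the action is hermitian
quadratic in `A`. -/
lemma actionYM_add_smul (A : InvΓ →ₗ[ℂ] Form 1) (z : ℂ) :
    actionYM (omegaTriv + tensorAd 0 A + z • tensorAd 0 A) =
      actionYM (omegaTriv + tensorAd 0 A) * ((1 + z) * star (1 + z)) := by
  have h : omegaTriv + tensorAd 0 A + z • tensorAd 0 A =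
      omegaTriv + tensorAd 0 ((1 + z) • A) := by
    rw [add_assoc]
    congr 1
    ext1 θ
    simp only [LinearMap.add_apply, LinearMap.smul_apply, tensorAd_apply, map_smul]
    module
  rw [h, actionYM_eq, actionYM_eq, LinearMap.smul_apply, map_smul, metricL_smul_smul,
    Matrix.trace_smul, smul_eq_mul]
  ring

/-- $\partial_z$ treats $\bar z$ as a constant, so the derivative is $c(1+\bar z)$, with value $c$
at $0$. -/
lemma wirtinger_mul_normSq (c : ℂ) :
    wirtinger (fun z => c * ((1 + z) * star (1 + z))) 0 = c := by
  have h1 : HasFDerivAt (𝕜 := ℝ) (fun z : ℂ => 1 + z) (ContinuousLinearMap.id ℝ ℂ) 0 :=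
    (hasFDerivAt_id _).const_add _
  have h2 : HasFDerivAt (𝕜 := ℝ) (fun z : ℂ => star (1 + z))
      (Complex.conjCLE.toContinuousLinearMap.comp (ContinuousLinearMap.id ℝ ℂ)) 0 :=
    Complex.conjCLE.toContinuousLinearMap.hasFDerivAt.comp _ h1
  have h3 : HasFDerivAt (𝕜 := ℝ) (fun z : ℂ => c * ((1 + z) * star (1 + z))) _ 0 :=
    (h1.mul h2).const_mul c
  rw [wirtinger, h3.fderiv]
  simp
  ring

lemma IsYangMills.ceD_one_varsigma_eq_zero {ω : InvΓ →ₗ[ℂ] TotalForm 0} (h : IsYangMills ω)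
    {A : InvΓ →ₗ[ℂ] Form 1} (hA : IsGaugePotential ω A) : ceD 1 (A varsigma) = 0 := by
  -- Stationarity is needed only in the direction of $A\otimes 1$; it says that the action at
  -- $\omega$ is zero.
  have hw := (h.2 (tensorAd 0 A) (isDisplacement_tensorAd A)).2
  rw [hA] at hw
  simp only [actionYM_add_smul, wirtinger_mul_normSq] at hw
  rw [actionYM_eq] at hw
  exact eq_zero_of_trace_metricL_eq_zero ((mul_eq_zero.1 hw).resolve_left (by norm_num))

end NCYM

theorem mainTheorem12 :
    -- the first Chevalley-Eilenberg cohomology vanishes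
    LinearMap.ker (NCYM.ceD 1) = LinearMap.range (NCYM.ceD 0) ∧
    ∀ ω : NCYM.InvΓ →ₗ[ℂ] NCYM.TotalForm 0, NCYM.IsYangMills ω →
      NCYM.IsFlat ω ∧
      ∃ A : NCYM.InvΓ →ₗ[ℂ] NCYM.Form 1,
        NCYM.IsGaugePotential ω A ∧
        (∀ A' : NCYM.InvΓ →ₗ[ℂ] NCYM.Form 1, NCYM.IsGaugePotential ω A' → A' = A) ∧
        NCYM.curvature ω = NCYM.tensorAd 1 (NCYM.fieldStrength A) ∧
        NCYM.fieldStrength A NCYM.varsigma = NCYM.ceD 1 (A NCYM.varsigma) ∧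
        NCYM.fieldStrength A NCYM.varsigma = 0 ∧
        ∃ p : NCYM.M2, A NCYM.varsigma = NCYM.ceD 0 (NCYM.ofM p) := by
  refine ⟨NCYM.ker_ceD_one, fun ω hω => ?_⟩
  have hA := hω.1.isGaugePotential
  -- From here on only the decomposition `hA` of `ω` matters, not the formula for its potential.
  generalize NCYM.toBase 0 ∘ₗ ω = A at hA
  have hd := hω.ceD_one_varsigma_eq_zero hA
  have hR : NCYM.curvature ω = NCYM.tensorAd 1 (NCYM.fieldStrength A) := by
    rw [hA, NCYM.curvature_omegaTriv_add]
  have hF : NCYM.fieldStrength A = 0 := by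
    apply NCYM.invΓ_hom_ext
    rw [NCYM.fieldStrength_eq, LinearMap.comp_apply, hd, LinearMap.zero_apply]
  refine ⟨?_, A, hA, fun A' hA' => hA'.eq_toBase.trans hA.eq_toBase.symm, hR, ?_, ?_, ?_⟩
  · rw [NCYM.IsFlat, hR, hF]
    ext1 θ
    rw [NCYM.tensorAd_apply, LinearMap.zero_apply, map_zero, LinearMap.zero_apply]
  · rw [NCYM.fieldStrength_eq, LinearMap.comp_apply]
  · rw [hF, LinearMap.zero_apply]
  · have hmem : A NCYM.varsigma ∈ LinearMap.range (NCYM.ceD 0) := NCYM.ker_ceD_one ▸ hd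
    obtain ⟨f, hf⟩ := hmem
    exact ⟨NCYM.ofM.symm f, by rw [LinearEquiv.apply_symm_apply, hf]⟩
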